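/- Conventions. For $X,Y\subseteq\mathbb{N}$ write $X\subseteq^* Y$ if $X\setminus Y$ is finite. An infinite set $C\subseteq\mathbb{N}$ is cohesive if for every c.e. set $W$ either $C\subseteq^* W$ or $C\subseteq^*\mathbb{N}\setminus W$; it is co-c.e. if $\mathbb{N}\setminus C$ is c.e. For a computable linear order $\mathcal{L}=(L,\prec_{\mathcal{L}})$ with non-empty computable domain $L\subseteq\mathbb{N}$, the cohesive power $\Pi_C\mathcal{L}$ has as elements the classes $[\varphi]$ of partial computable functions $\varphi\colon\mathbb{N}\to L$ with $C\subseteq^*\operatorname{dom}\varphi$, where $[\varphi]=[\psi]$ iff $\varphi(n){\downarrow}=\psi(n){\downarrow}$ for almost every $n\in C$, and $[\varphi]\prec_{\Pi_C\mathcal{L}}[\psi]$ iff $\varphi(n){\downarrow}\prec_{\mathcal{L}}\psi(n){\downarrow}$ for almost every $n\in C$. An element of $\Pi_C\mathcal{L}$ is standard if it is the class of a constant function with value in $L$, and non-standard otherwise. Colors of elements of $\Pi_C\mathcal{L}$ are the classes $[\![\delta]\!]$, under the same equivalence, of partial computable $\delta\colon\mathbb{N}\to\mathbb{N}$ with $C\subseteq^*\operatorname{dom}\delta$;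 the color $[\![\delta]\!]$ is solid if there is an $x\in\mathbb{N}$ with $\delta(n)=x$ for almost every $n\in C$, and striped otherwise. A computable coloring $F\colon L\to\mathbb{N}$ induces the coloring $\widehat{F}([\varphi])=[\![F\circ\varphi]\!]$ of $\Pi_C\mathcal{L}$. Let $\omega$ and $\eta$ be the order-types of $(\mathbb{N},<)$ and $(\mathbb{Q},<)$. Theorem. Let $C$ be a co-c.e. cohesive set. Then there are a computable linear order $\mathcal{L}=(\mathbb{N},\prec_{\mathcal{L}})$ of order-type $\omega$ and a computable coloring $F\colon\mathbb{N}\to\mathbb{N}$ such that $\Pi_C\mathcal{L}$ has order-type $\omega+\eta$ and the following holds. Let $[\psi]\prec_{\Pi_C\mathcal{L}}[\varphi]$ be any two non-standard elements of $\Pi_C\mathcal{L}$. Then for every solid color $[\![\delta]\!]$ there is a non-standard $[\theta]$ in $\Pi_C\mathcal{L}$ with $[\psi]\prec_{\Pi_C\mathcal{L}}[\theta]\prec_{\Pi_C\mathcal{L}}[\varphi]$ and $\widehat{F}([\theta])=[\![\delta]\!]$; and there is also a non-standard $[\theta]$ in $\Pi_C\mathcal{L}$ with $[\psi]\prec_{\Pi_C\mathcal{L}}[\theta]\prec_{\Pi_C\mathcal{L}}[\varphi]$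 for which $\widehat{F}([\theta])$ is a striped color. -/

import Mathlib

namespace CohPow

/-- `C ⊆* X`: all but finitely many elements of `C` belong to `X`. -/
def AlmostSubset (C X : Set ℕ) : Prop := (C \ X).Finite

/-- `W` is computably enumerable. -/
def IsCE (W : Set ℕ) : Prop := REPred fun n => n ∈ W

/-- `C` is co-c.e. -/
def IsCoCE (C : Set ℕ) : Prop := IsCE Cᶜ

/-- An infinite set `C` is cohesive if every c.e. set `W` satisfies `C ⊆* W` or `C ⊆* Wᶜ`. -/
def IsCohesive (C : Set ℕ) : Prop :=
  C.Infinite ∧ ∀ W : Set ℕ, IsCE W → AlmostSubset C W ∨ AlmostSubset C Wᶜ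

/-- A computable linear order: a non-empty computable domain `dom ⊆ ℕ` with a computable
(strict) linear order `lt` on it. -/
structure ComputableLinearOrder where
  dom : Set ℕ
  lt : ℕ → ℕ → Prop
  dom_nonempty : dom.Nonempty
  dom_computable : ComputablePred fun n => n ∈ dom
  lt_computable : ComputablePred fun p : ℕ × ℕ => lt p.1 p.2
  lt_dom : ∀ a b, lt a b → a ∈ dom ∧ b ∈ dom
  irrefl : ∀ a ∈ dom, ¬ lt a a
  asymm : ∀ a ∈ dom, ∀ b ∈ dom, lt a b → ¬ lt b a
  trans : ∀ a ∈ dom, ∀ b ∈ dom, ∀ c ∈ dom, lt a b → lt b c → lt a c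
  total : ∀ a ∈ dom, ∀ b ∈ dom, lt a b ∨ a = b ∨ lt b a

/-- The linear order `L` has order-type `ω`. -/
def ComputableLinearOrder.IsCopyOfOmega (L : ComputableLinearOrder) : Prop :=
  Nonempty ((fun a b : L.dom => L.lt a b) ≃r ((· < ·) : ℕ → ℕ → Prop))

theorem AlmostSubset.mono {C X Y : Set ℕ} (h : AlmostSubset C X) (hXY : X ⊆ Y) :
    AlmostSubset C Y :=
  Set.Finite.subset h fun _ hn => ⟨hn.1, fun hX => hn.2 (hXY hX)⟩

theorem AlmostSubset.inter {C X Y : Set ℕ} (hX : AlmostSubset C X) (hY : AlmostSubset C Y) :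
    AlmostSubset C (X ∩ Y) := by
  refine (Set.Finite.union hX hY).subset ?_
  rintro n ⟨hC, hn⟩
  by_cases h : n ∈ X
  · exact Or.inr ⟨hC, fun h' => hn ⟨h, h'⟩⟩
  · exact Or.inl ⟨hC, h⟩

/-- The partial computable functions `φ : ℕ → A` with `C ⊆* dom φ`. -/
def Rep (A C : Set ℕ) : Type :=
  {φ : ℕ →. ℕ // Partrec φ ∧ (∀ n, ∀ a ∈ φ n, a ∈ A) ∧ AlmostSubset C φ.Dom}

/-- `φ =_C ψ`: for almost every `n ∈ C`, `φ n` and `ψ n` are defined and equal. -/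
def EqC {A C : Set ℕ} (φ ψ : Rep A C) : Prop :=
  AlmostSubset C {n | ∃ a, a ∈ φ.1 n ∧ a ∈ ψ.1 n}

instance repSetoid (A C : Set ℕ) : Setoid (Rep A C) where
  r := EqC
  iseqv :=
    { refl := fun φ => φ.2.2.2.mono fun n hn =>
        ⟨(φ.1 n).get hn, Part.get_mem hn, Part.get_mem hn⟩
      symm := fun h => AlmostSubset.mono h fun _ ⟨a, h₁, h₂⟩ => ⟨a, h₂, h₁⟩
      trans := fun h₁ h₂ => (AlmostSubset.inter h₁ h₂).mono fun _ ⟨⟨a, ha, hb⟩, ⟨b, hb', hc⟩⟩ =>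
        ⟨a, ha, by rwa [Part.mem_unique hb hb']⟩ }

/-- The domain of the cohesive power over `C` of a structure with domain `A`: the classes `[φ]`. -/
def Power (A C : Set ℕ) : Type := Quotient (repSetoid A C)

/-- The class `[φ]` of a representative `φ`. -/
def Power.mk {A C : Set ℕ} (φ : Rep A C) : Power A C := Quotient.mk (repSetoid A C) φ

/-- The relation on `Power A C` induced by a binary relation `R`: `R [φ] [ψ]` holds if and only if
`φ n` and `ψ n` are defined and `R (φ n) (ψ n)` holds, for almost every `n ∈ C`. -/
def powerRel {A C : Set ℕ} (R : ℕ → ℕ → Prop) : Power A C → Power A C → Prop :=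
  Quotient.lift₂
    (fun φ ψ : Rep A C => AlmostSubset C {n | ∃ a ∈ φ.1 n, ∃ b ∈ ψ.1 n, R a b})
    (by
      have key : ∀ φ ψ φ' ψ' : Rep A C, EqC φ φ' → EqC ψ ψ' →
          AlmostSubset C {n | ∃ a ∈ φ.1 n, ∃ b ∈ ψ.1 n, R a b} →
          AlmostSubset C {n | ∃ a ∈ φ'.1 n, ∃ b ∈ ψ'.1 n, R a b} := by
        intro φ ψ φ' ψ' h₁ h₂ h
        refine (AlmostSubset.inter h (AlmostSubset.inter h₁ h₂)).mono ?_
        rintro n ⟨⟨a, ha, b, hb, hR⟩, ⟨a', ha', ha''⟩, ⟨b', hb', hb''⟩⟩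
        rw [Part.mem_unique ha ha', Part.mem_unique hb hb'] at hR
        exact ⟨a', ha'', b', hb'', hR⟩
      intro φ ψ φ' ψ' h₁ h₂
      exact propext ⟨key _ _ _ _ h₁ h₂, key _ _ _ _ (Setoid.symm h₁) (Setoid.symm h₂)⟩)

/-- The domain of the cohesive power `Π_C L` of a computable linear order `L`. -/
abbrev ComputableLinearOrder.Power (L : ComputableLinearOrder) (C : Set ℕ) : Type :=
  CohPow.Power L.dom C

/-- The order relation of the cohesive power `Π_C L`. -/
def ComputableLinearOrder.powerLt (L : ComputableLinearOrder) (C : Set ℕ) :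
    L.Power C → L.Power C → Prop :=
  powerRel L.lt

/-- The total function with constant value `a ∈ A`. -/
def constRep {A : Set ℕ} (C : Set ℕ) (a : A) : Rep A C :=
  ⟨fun _ => Part.some a.1, (Computable.const a.1).partrec,
    fun _ b hb => by rw [Part.mem_some_iff.1 hb]; exact a.2,
    Set.Finite.subset Set.finite_empty fun _ hn => hn.2 trivial⟩

/-- The canonical embedding `a ↦ [constant function with value a]`. -/
def canonicalEmbedding {A : Set ℕ} (C : Set ℕ) (a : A) : Power A C :=
  Power.mk (constRep C a)

/-- An element of a cohesive power is standard if it is in the image of the canonical embedding. -/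
def IsStandard {A C : Set ℕ} (x : Power A C) : Prop :=
  x ∈ Set.range (canonicalEmbedding (A := A) C)

/-- Colors of elements of a cohesive power over `C`: the classes `⟦δ⟧` of partial computable
functions `δ : ℕ → ℕ` with `C ⊆* dom δ`. -/
abbrev Color (C : Set ℕ) : Type := Power Set.univ C

/-- The representative `F ∘ φ`. -/
def compRep {A C : Set ℕ} (F : ℕ → ℕ) (hF : Computable F) (φ : Rep A C) : Rep Set.univ C :=
  ⟨fun n => (φ.1 n).map F, φ.2.1.map (hF.comp Computable.snd).to₂, fun _ _ _ => trivial, φ.2.2.2⟩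

/-- The coloring `[φ] ↦ ⟦F ∘ φ⟧` of a cohesive power induced by a computable coloring `F`. -/
def inducedColoring {A C : Set ℕ} (F : ℕ → ℕ) (hF : Computable F) : Power A C → Color C :=
  Quotient.lift (fun φ => Power.mk (compRep F hF φ)) fun φ ψ h =>
    Quotient.sound (s := repSetoid Set.univ C) <| AlmostSubset.mono (X := {n | ∃ a, a ∈ φ.1 n ∧ a ∈ ψ.1 n}) h
      fun _ ⟨a, h₁, h₂⟩ => ⟨F a, Part.mem_map F h₁, Part.mem_map F h₂⟩

/-- The color `⟦δ⟧` is solid if there is an `x` with `δ n = x` for almost every `n ∈ C`. -/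
def IsSolid {C : Set ℕ} : Color C → Prop :=
  Quotient.lift (fun δ : Rep Set.univ C => ∃ x : ℕ, AlmostSubset C {n | x ∈ δ.1 n})
    (by
      have key : ∀ δ δ' : Rep Set.univ C, EqC δ δ' →
          (∃ x : ℕ, AlmostSubset C {n | x ∈ δ.1 n}) →
          ∃ x : ℕ, AlmostSubset C {n | x ∈ δ'.1 n} := by
        rintro δ δ' h ⟨x, hx⟩
        refine ⟨x, (AlmostSubset.inter hx h).mono ?_⟩
        rintro n ⟨hn, a, ha, ha'⟩
        rwa [Part.mem_unique ha hn] at ha'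
      intro δ δ' h
      exact propext ⟨key _ _ h, key _ _ (Setoid.symm h)⟩)

/-- A color that is not solid is striped. -/
def IsStriped {C : Set ℕ} (c : Color C) : Prop := ¬ IsSolid c

end CohPow

namespace CohPow

/-! ### Construction of the order by stages -/

open Nat.Partrec (Code)
open Denumerable

/-! Fix a machine `w` whose domain is the complement of `C`. The order is built by inserting the
numbers s = ⟨t, u⟩ one at a time. The tag is t = ⟨e, n⟩, where e = ⟨⟨p, q⟩, c⟩ codes two partial
functions and a colour rule. Suppose that p(n) = a and q(n) = b are found within u steps, with a
below b. Then s goes directly above a, provided that no element with tag t yet separates a from b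
and that every j ≤ e + #{i < n : `w` has not accepted i in u steps} already present is below a. In
all other cases s goes on top.

The last proviso, a restraint, secures order-type ω. An element can be put below k only for a tag
with e + |C ∩ n| < k. As `C` is infinite there are finitely many such tags, and each makes at most
one insertion (`finite_not_before`).

The restraint does not harm density. If [ψ] is non-standard, the least number not below ψ(n) tends
to infinity along `C`. Since `C` is cohesive and co-c.e., a partial computable function tending to
infinity along `C` is eventually strictly increasing on `C` (`eventually_strictMonoOn`), hence it
dominates e + |C ∩ n| (`eventually_add_ncard_lt`). Once u is so large that the survivors below n are
exactly C ∩ n, the restraint is met. So for [ψ] below [φ] and almost every n in `C` some element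
tagged ⟨e, n⟩ lies between ψ(n) and φ(n) (`exists_between`), and unbounded search assembles these
into one element of the power (`exists_between_nonstandard`).

Rule c + 1 gives the constant colour c and rule 0 gives the colour n, which is striped. Cantor's
theorem turns the density of the non-standard part into η. -/

/-- The number of `i < n` that the machine `w` has not accepted within `u` steps. -/
def survivors (w : Code) (u n : ℕ) : ℕ :=
  ((List.range n).filter fun i => w.evaln u i = none).length

/-- The code of the lower function named by a tag. -/
def lowerCode (t : ℕ) : Code := ofNat Code t.unpair.1.unpair.1.unpair.1

/-- The code of the upper function named by a tag. -/
def upperCode (t : ℕ) : Code := ofNat Code t.unpair.1.unpair.1.unpair.2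

/-- Whether a new element with tag `t` may be inserted directly above `a`, in order to separate `a`
from `b`, where `l` lists the ranks of the elements that are present. -/
def Admissible (w : Code) (l : List ℕ) (t u a b : ℕ) : Prop :=
  (∀ j < t.unpair.1 + survivors w u t.unpair.2 + 1, j < l.length → l.getD j 0 < l.getD a 0) ∧
    l.getD a 0 < l.getD b 0 ∧
    ∀ x < l.length, ¬ (x.unpair.1 = t ∧ l.getD a 0 < l.getD x 0 ∧ l.getD x 0 < l.getD b 0)

instance (w : Code) (l : List ℕ) (t u a b : ℕ) : Decidable (Admissible w l t u a b) := by
  unfold Admissible; infer_instance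

/-- The element directly above which the next element is inserted, if there is one. -/
def anchor (w : Code) (l : List ℕ) : Option ℕ :=
  ((lowerCode l.length.unpair.1).evaln l.length.unpair.2 l.length.unpair.1.unpair.2).bind fun a =>
    ((upperCode l.length.unpair.1).evaln l.length.unpair.2 l.length.unpair.1.unpair.2).bind fun b =>
      if Admissible w l l.length.unpair.1 l.length.unpair.2 a b then some a else none

/-- The ranks after the insertion of one more element. -/
def nextRanks (w : Code) (l : List ℕ) : List ℕ :=
  l.map (2 * ·) ++ [2 * ((anchor w l).casesOn l.sum fun a => l.getD a 0) + 1]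

/-- The ranks of the elements `0, …, s - 1`. -/
def ranks (w : Code) : ℕ → List ℕ
  | 0 => []
  | s + 1 => nextRanks w (ranks w s)

/-- The rank of `x` among `0, …, s - 1`. -/
def rank (w : Code) (s x : ℕ) : ℕ := (ranks w s).getD x 0

/-- The strict order on `ℕ` given by the ranks. -/
def Before (w : Code) (x y : ℕ) : Prop := rank w (max x y + 1) x < rank w (max x y + 1) y

/-! ### Primitive recursiveness of the construction -/

section Computability

theorem primrec_evaln_comp {α : Type*} [Primcodable α] {u n : α → ℕ} {c : α → Code}
    (hu : Primrec u) (hc : Primrec c) (hn : Primrec n) :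
    Primrec fun x => Code.evaln (u x) (c x) (n x) :=
  Code.primrec_evaln.comp ((hu.pair hc).pair hn)

theorem primrec_survivors (w : Code) : Primrec₂ (survivors w) := by
  have h : PrimrecRel fun i u : ℕ => w.evaln u i = none :=
    (Primrec.eq (α := Option ℕ)).comp
      (primrec_evaln_comp Primrec.snd (Primrec.const w) Primrec.fst) (Primrec.const none)
  exact Primrec.list_length.comp
    (h.listFilter.comp (Primrec.list_range.comp Primrec.snd) Primrec.fst)

theorem primrec_fst_unpair : Primrec fun n : ℕ => n.unpair.1 := Primrec.fst.comp Primrec.unpair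

theorem primrec_snd_unpair : Primrec fun n : ℕ => n.unpair.2 := Primrec.snd.comp Primrec.unpair

theorem primrec_lowerCode : Primrec lowerCode :=
  (Primrec.ofNat Code).comp
    (primrec_fst_unpair.comp (primrec_fst_unpair.comp primrec_fst_unpair))

theorem primrec_upperCode : Primrec upperCode :=
  (Primrec.ofNat Code).comp
    (primrec_snd_unpair.comp (primrec_fst_unpair.comp primrec_fst_unpair))

theorem primrec_getD {α : Type*} [Primcodable α] {l : α → List ℕ} {n : α → ℕ} (hl : Primrec l)
    (hn : Primrec n) : Primrec fun x => (l x).getD (n x) 0 :=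
  (Primrec.list_getD 0).comp hl hn

theorem primrecPred_forall_lt {α : Type*} [Primcodable α] {R : ℕ → α → Prop} (hR : PrimrecRel R)
    {k : α → ℕ} (hk : Primrec k) : PrimrecPred fun x => ∀ j < k x, R j x :=
  (hR.forall_mem_list.comp (Primrec.list_range.comp hk) Primrec.id).of_eq fun x => by simp

theorem primrecPred_admissible (w : Code) :
    PrimrecPred fun x : (List ℕ × ℕ × ℕ) × ℕ × ℕ =>
      Admissible w x.1.1 x.1.2.1 x.1.2.2 x.2.1 x.2.2 := by
  let α := (List ℕ × ℕ × ℕ) × ℕ × ℕ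
  have hl : Primrec fun x : α => x.1.1 := Primrec.fst.comp Primrec.fst
  have ht : Primrec fun x : α => x.1.2.1 := Primrec.fst.comp (Primrec.snd.comp Primrec.fst)
  have hu : Primrec fun x : α => x.1.2.2 := Primrec.snd.comp (Primrec.snd.comp Primrec.fst)
  have ha : Primrec fun x : α => x.2.1 := Primrec.fst.comp Primrec.snd
  have hb : Primrec fun x : α => x.2.2 := Primrec.snd.comp Primrec.snd
  have hk : Primrec fun x : α => x.1.2.1.unpair.1 + survivors w x.1.2.2 x.1.2.1.unpair.2 + 1 :=
    Primrec.succ.comp (Primrec.nat_add.comp (primrec_fst_unpair.comp ht)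
      ((primrec_survivors w).comp hu (primrec_snd_unpair.comp ht)))
  have h₁ : PrimrecRel fun (j : ℕ) (x : α) =>
      j < x.1.1.length → x.1.1.getD j 0 < x.1.1.getD x.2.1 0 := by
    have h := (Primrec.nat_lt.comp Primrec.fst
      (Primrec.list_length.comp (hl.comp Primrec.snd)) :
        PrimrecPred fun y : ℕ × α => y.1 < y.2.1.1.length)
    have h' := (Primrec.nat_lt.comp (primrec_getD (hl.comp Primrec.snd) Primrec.fst)
      (primrec_getD (hl.comp Primrec.snd) (ha.comp Primrec.snd)) :
        PrimrecPred fun y : ℕ × α => y.2.1.1.getD y.1 0 < y.2.1.1.getD y.2.2.1 0)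
    exact (h.not.or h').of_eq fun y => imp_iff_not_or.symm
  have h₂ : PrimrecRel fun (z : ℕ) (x : α) =>
      ¬ (z.unpair.1 = x.1.2.1 ∧ x.1.1.getD x.2.1 0 < x.1.1.getD z 0 ∧
        x.1.1.getD z 0 < x.1.1.getD x.2.2 0) := by
    have hz : Primrec fun y : ℕ × α => y.2.1.1.getD y.1 0 :=
      primrec_getD (hl.comp Primrec.snd) Primrec.fst
    exact PrimrecPred.not (PrimrecPred.and
      (Primrec.eq.comp (primrec_fst_unpair.comp Primrec.fst) (ht.comp Primrec.snd))
      (PrimrecPred.and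
        (Primrec.nat_lt.comp (primrec_getD (hl.comp Primrec.snd) (ha.comp Primrec.snd)) hz)
        (Primrec.nat_lt.comp hz (primrec_getD (hl.comp Primrec.snd) (hb.comp Primrec.snd)))))
  exact PrimrecPred.and (primrecPred_forall_lt h₁ hk) (PrimrecPred.and
    (Primrec.nat_lt.comp (primrec_getD hl ha) (primrec_getD hl hb))
    (primrecPred_forall_lt h₂ (Primrec.list_length.comp hl)))

theorem primrecPred_admissible_comp {α : Type*} [Primcodable α] (w : Code) {l : α → List ℕ}
    {t u a b : α → ℕ} (hl : Primrec l) (ht : Primrec t) (hu : Primrec u) (ha : Primrec a)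
    (hb : Primrec b) : PrimrecPred fun x => Admissible w (l x) (t x) (u x) (a x) (b x) :=
  (primrecPred_admissible w).comp ((hl.pair (ht.pair hu)).pair (ha.pair hb))

theorem primrec_anchor (w : Code) : Primrec (anchor w) := by
  have ht : Primrec fun l : List ℕ => l.length.unpair.1 :=
    primrec_fst_unpair.comp Primrec.list_length
  have hu : Primrec fun l : List ℕ => l.length.unpair.2 :=
    primrec_snd_unpair.comp Primrec.list_length
  have hn : Primrec fun l : List ℕ => l.length.unpair.1.unpair.2 := primrec_snd_unpair.comp ht
  have hl : Primrec fun x : (List ℕ × ℕ) × ℕ => x.1.1 := Primrec.fst.comp Primrec.fst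
  have hite : Primrec₂ fun (x : List ℕ × ℕ) (b : ℕ) =>
      if Admissible w x.1 x.1.length.unpair.1 x.1.length.unpair.2 x.2 b
        then some x.2 else none :=
    Primrec.ite (primrecPred_admissible_comp w hl (ht.comp hl) (hu.comp hl)
      (Primrec.snd.comp Primrec.fst) Primrec.snd)
      (Primrec.option_some.comp (Primrec.snd.comp Primrec.fst)) (Primrec.const none)
  have ha := primrec_evaln_comp hu (primrec_lowerCode.comp ht) hn
  have hb := (primrec_evaln_comp hu (primrec_upperCode.comp ht) hn).comp
    (Primrec.fst (α := List ℕ) (β := ℕ))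
  exact Primrec.option_bind ha (Primrec.option_bind hb hite).to₂

theorem primrec_list_sum : Primrec (List.sum : List ℕ → ℕ) :=
  (Primrec.list_foldr Primrec.id (Primrec.const 0)
    (Primrec.nat_add.comp (Primrec.fst.comp Primrec.snd) (Primrec.snd.comp Primrec.snd)).to₂).of_eq
    fun _ => rfl

theorem primrec_nextRanks (w : Code) : Primrec (nextRanks w) := by
  refine Primrec.list_concat.comp
    (Primrec.list_map Primrec.id (Primrec.nat_double.comp Primrec.snd).to₂)
    (Primrec.nat_double_succ.comp (Primrec.option_casesOn (primrec_anchor w) primrec_list_sum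
      (primrec_getD Primrec.fst Primrec.snd).to₂))

theorem primrec_ranks (w : Code) : Primrec (ranks w) :=
  (Primrec.nat_rec₁ (f := fun _ l => nextRanks w l) []
    ((primrec_nextRanks w).comp Primrec.snd).to₂).of_eq fun s => by
      induction s with
      | zero => rfl
      | succ s ih => simp only [ranks, ← ih]

theorem primrecRel_before (w : Code) : PrimrecRel (Before w) := by
  have h : Primrec fun p : ℕ × ℕ => ranks w (max p.1 p.2 + 1) :=
    (primrec_ranks w).comp (Primrec.succ.comp (Primrec.nat_max.comp Primrec.fst Primrec.snd))
  exact Primrec.nat_lt.comp (primrec_getD h Primrec.fst) (primrec_getD h Primrec.snd)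

end Computability

/-! ### The order, its finite initial segments, and separation -/

section Order

variable (w : Code)

theorem length_ranks (s : ℕ) : (ranks w s).length = s := by
  induction s with
  | zero => rfl
  | succ s ih => simp [ranks, nextRanks, ih]

theorem rank_succ_of_lt {s x : ℕ} (h : x < s) : rank w (s + 1) x = 2 * rank w s x := by
  have h' : x < (ranks w s).length := by rwa [length_ranks]
  simp [rank, ranks, nextRanks, List.getElem?_append, h']

theorem rank_succ_self (s : ℕ) : rank w (s + 1) s =
    2 * ((anchor w (ranks w s)).casesOn (ranks w s).sum fun a => rank w s a) + 1 := by
  have h : ¬ s < (ranks w s).length := by simp [length_ranks]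
  simp [rank, ranks, nextRanks, length_ranks]

theorem rank_of_le {s x : ℕ} (h : s ≤ x) : rank w s x = 0 := by
  have h' : (ranks w s).length ≤ x := by rwa [length_ranks]
  simp [rank, h']

/-- Every insertion doubles the old ranks, so a comparison never changes once both elements are
present. -/
theorem before_iff_rank {s x y : ℕ} (hx : x < s) (hy : y < s) :
    Before w x y ↔ rank w s x < rank w s y := by
  have key : ∀ s, max x y + 1 ≤ s → (Before w x y ↔ rank w s x < rank w s y) := by
    intro s hs
    induction s, hs using Nat.le_induction with
    | base => rfl
    | succ s hs ih => rw [ih, rank_succ_of_lt w (by omega), rank_succ_of_lt w (by omega)]; omega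
  exact key s (by omega)

theorem before_irrefl (x : ℕ) : ¬ Before w x x := lt_irrefl _

theorem before_trans {x y z : ℕ} (hxy : Before w x y) (hyz : Before w y z) : Before w x z := by
  have hx : x < x + y + z + 1 := by omega
  have hy : y < x + y + z + 1 := by omega
  have hz : z < x + y + z + 1 := by omega
  rw [before_iff_rank w hx hy] at hxy
  rw [before_iff_rank w hy hz] at hyz
  rw [before_iff_rank w hx hz]
  exact hxy.trans hyz

theorem before_total (x y : ℕ) : Before w x y ∨ x = y ∨ Before w y x := by
  -- When y is inserted its rank is odd, while that of the older x is even.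
  have key : ∀ x y, x < y → rank w (y + 1) x ≠ rank w (y + 1) y := by
    intro x y h
    rw [rank_succ_of_lt w h, rank_succ_self]
    omega
  rcases eq_or_ne x y with h | h
  · exact Or.inr (Or.inl h)
  have hne : rank w (max x y + 1) x ≠ rank w (max x y + 1) y := by
    rcases lt_or_gt_of_ne h with h | h
    · rw [max_eq_right h.le]; exact key _ _ h
    · rw [max_eq_left h.le]; exact (key _ _ h).symm
  rcases lt_or_gt_of_ne hne with h | h
  · exact Or.inl h
  · exact Or.inr (Or.inr (by rwa [Before, max_comm]))

theorem before_of_anchor_eq_none {s x : ℕ} (h : anchor w (ranks w s) = none) (hx : x < s) :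
    Before w x s := by
  rw [before_iff_rank w (s := s + 1) (by omega) (by omega), rank_succ_of_lt w hx, rank_succ_self, h]
  have hx' : x < (ranks w s).length := by rwa [length_ranks]
  -- No rank exceeds the sum of all ranks, so twice that sum plus one tops the doubled ranks.
  have : rank w s x ≤ (ranks w s).sum := by
    rw [rank, List.getD_eq_getElem _ _ hx']
    exact List.le_sum_of_mem (List.getElem_mem hx')
  simp only
  omega

/-- The rank 2r + 1 falls between 2r, the new rank of `a`, and the double of any larger rank. -/
theorem before_of_anchor_eq_some {s a x : ℕ} (h : anchor w (ranks w s) = some a) (ha : a < s)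
    (hx : x < s) : Before w x s ↔ x = a ∨ Before w x a := by
  rw [before_iff_rank w (s := s + 1) (by omega) (by omega), rank_succ_of_lt w hx, rank_succ_self, h,
    before_iff_rank w hx ha]
  simp only
  constructor
  · intro hlt
    rcases before_total w x a with h' | h' | h'
    · exact Or.inr ((before_iff_rank w hx ha).1 h')
    · exact Or.inl h'
    · rw [before_iff_rank w ha hx] at h'; omega
  · rintro (rfl | h') <;> omega

/-- The insertion condition, in terms of the order. -/
def Separates (s a b : ℕ) : Prop :=
  a ∈ (lowerCode s.unpair.1).evaln s.unpair.2 s.unpair.1.unpair.2 ∧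
  b ∈ (upperCode s.unpair.1).evaln s.unpair.2 s.unpair.1.unpair.2 ∧ a < s ∧ b < s ∧
  (∀ j ≤ s.unpair.1.unpair.1 + survivors w s.unpair.2 s.unpair.1.unpair.2, j < s → Before w j a) ∧
  Before w a b ∧ ∀ x < s, ¬ (x.unpair.1 = s.unpair.1 ∧ Before w a x ∧ Before w x b)

/-- Absent elements have the default rank 0. Hence the strict inequality between `a` and `b` forces
`b` to be present, and then the restraint at j = 0 forces `a` to be present. -/
theorem admissible_iff {s t u a b : ℕ} : Admissible w (ranks w s) t u a b ↔ a < s ∧ b < s ∧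
    (∀ j ≤ t.unpair.1 + survivors w u t.unpair.2, j < s → Before w j a) ∧
    Before w a b ∧ ∀ x < s, ¬ (x.unpair.1 = t ∧ Before w a x ∧ Before w x b) := by
  have hr : ∀ x, (ranks w s).getD x 0 = rank w s x := fun _ => rfl
  unfold Admissible
  simp only [length_ranks, hr, Nat.lt_succ_iff]
  have hlt : rank w s a < rank w s b → b < s := by
    intro h
    by_contra hb
    rw [rank_of_le w (not_lt.1 hb)] at h
    omega
  constructor
  · rintro ⟨h₁, h₂, h₃⟩
    have hb := hlt h₂
    have ha : a < s := by
      by_contra ha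
      have := h₁ 0 (by omega) (by omega)
      rw [rank_of_le w (not_lt.1 ha)] at this
      omega
    refine ⟨ha, hb, fun j hj hjs => (before_iff_rank w hjs ha).2 (h₁ j hj hjs),
      (before_iff_rank w ha hb).2 h₂, fun x hx => ?_⟩
    rw [before_iff_rank w ha hx, before_iff_rank w hx hb]
    exact h₃ x hx
  · rintro ⟨ha, hb, h₁, h₂, h₃⟩
    refine ⟨fun j hj hjs => (before_iff_rank w hjs ha).1 (h₁ j hj hjs),
      (before_iff_rank w ha hb).1 h₂, fun x hx => ?_⟩
    rw [← before_iff_rank w ha hx, ← before_iff_rank w hx hb]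
    exact h₃ x hx

theorem anchor_eq_some_iff {s a : ℕ} :
    anchor w (ranks w s) = some a ↔ ∃ b, Separates w s a b := by
  simp only [anchor, length_ranks, Option.bind_eq_some_iff, Option.ite_none_right_eq_some,
    Option.some.injEq, admissible_iff, Separates, Option.mem_def]
  constructor
  · rintro ⟨a', ha, b, hb, h, rfl⟩
    exact ⟨b, ha, hb, h⟩
  · rintro ⟨b, ha, hb, h⟩
    exact ⟨a, ha, b, hb, h, rfl⟩

theorem Separates.before_self {w : Code} {s a b : ℕ} (h : Separates w s a b) : Before w a s := by
  obtain ⟨-, -, ha, -⟩ := id h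
  exact (before_of_anchor_eq_some w ((anchor_eq_some_iff w).2 ⟨b, h⟩) ha ha).2 (Or.inl rfl)

theorem Separates.self_before {w : Code} {s a b : ℕ} (h : Separates w s a b) : Before w s b := by
  obtain ⟨-, -, ha, hb, -, hab, -⟩ := id h
  rcases before_total w s b with h' | h' | h'
  · exact h'
  · omega
  · rcases (before_of_anchor_eq_some w ((anchor_eq_some_iff w).2 ⟨b, h⟩) ha hb).1 h' with rfl | h'
    · exact absurd hab (before_irrefl w _)
    · exact absurd (before_trans w h' hab) (before_irrefl w _)

/-- At most one insertion is made for each tag. -/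
theorem Separates.eq_of_tag_eq {w : Code} {s a b s' a' b' : ℕ} (h : Separates w s a b)
    (h' : Separates w s' a' b') (ht : s.unpair.1 = s'.unpair.1) : s = s' := by
  have key : ∀ {s a b s' a' b' : ℕ}, Separates w s a b → Separates w s' a' b' →
      s.unpair.1 = s'.unpair.1 → ¬ s < s' := by
    intro s a b s' a' b' h h' ht hlt
    -- The tag fixes both computations, so the values do not depend on the number of steps. The
    -- earlier insertion therefore still separates them and blocks the later one.
    have haa : a = a' := Part.mem_unique (Code.evaln_sound h.1)
      (ht ▸ Code.evaln_sound h'.1)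
    have hbb : b = b' := Part.mem_unique (Code.evaln_sound h.2.1)
      (ht ▸ Code.evaln_sound h'.2.1)
    subst haa hbb
    exact h'.2.2.2.2.2.2 s hlt ⟨ht, h.before_self, h.self_before⟩
  exact le_antisymm (not_lt.1 (key h' h ht.symm)) (not_lt.1 (key h h' ht))

/-- If the machine `w` accepts a coinfinite set, then every element is below almost all others. -/
theorem finite_not_before (hw : {n | ¬ (w.eval n).Dom}.Infinite) (k : ℕ) :
    {x | ¬ Before w k x}.Finite := by
  -- `D` consists of k numbers that are never accepted; for n beyond all of them, at least k numbers
  -- survive at every u.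
  obtain ⟨D, hDsub, hDcard⟩ := hw.exists_subset_card_eq k
  have hsurv : ∀ u n, D.sup id < n → k ≤ survivors w u n := by
    intro u n hn
    rw [← hDcard, survivors, ← List.toFinset_card_of_nodup (List.nodup_range.filter _)]
    refine Finset.card_le_card fun i hi => ?_
    have hin : i < n := (Finset.le_sup (f := id) hi).trans_lt hn
    have hi' : w.evaln u i = none := by
      by_contra hne
      obtain ⟨y, hy⟩ := Option.ne_none_iff_exists'.1 hne
      exact hDsub hi (Part.dom_iff_mem.2 ⟨y, Code.evaln_sound hy⟩)
    simp [hin, hi']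
  have htags : (Nat.unpair ⁻¹' (Set.Iio k ×ˢ Set.Iic (D.sup id))).Finite :=
    ((Set.finite_Iio k).prod (Set.finite_Iic _)).preimage
      (Function.Injective.injOn fun _ _ h => by
        simpa using congrArg (fun p : ℕ × ℕ => Nat.pair p.1 p.2) h)
  have hacts : {s | (∃ a b, Separates w s a b) ∧
      s.unpair.1 ∈ Nat.unpair ⁻¹' (Set.Iio k ×ˢ Set.Iic (D.sup id))}.Finite := by
    refine Set.Finite.of_finite_image (f := fun s => s.unpair.1) (htags.subset ?_) ?_
    · rintro _ ⟨s, hs, rfl⟩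
      exact hs.2
    · rintro s ⟨⟨a, b, h⟩, -⟩ s' ⟨⟨a', b', h'⟩, -⟩ ht
      exact h.eq_of_tag_eq h' ht
  refine (hacts.union (Set.finite_Iic k)).subset fun s hs => ?_
  by_cases hsk : s ≤ k
  · exact Or.inr hsk
  rw [not_le] at hsk
  refine Or.inl ?_
  cases hanc : anchor w (ranks w s) with
  | none => exact absurd (before_of_anchor_eq_none w hanc hsk) hs
  | some a =>
    obtain ⟨b, h⟩ := (anchor_eq_some_iff w).1 hanc
    refine ⟨⟨a, b, h⟩, ?_⟩
    -- Were k below `a`, it would be below s too. So the restraint of s does not reach k, which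
    -- bounds both parts of the tag.
    have hka : ¬ Before w k a := fun h' =>
      hs ((before_of_anchor_eq_some w hanc h.2.2.1 hsk).2 (Or.inr h'))
    have hlt : s.unpair.1.unpair.1 + survivors w s.unpair.2 s.unpair.1.unpair.2 < k := by
      by_contra hle
      exact hka (h.2.2.2.2.1 k (not_lt.1 hle) hsk)
    refine ⟨?_, ?_⟩
    · simp only [Set.mem_Iio]; omega
    · by_contra hgt
      have := hsurv s.unpair.2 s.unpair.1.unpair.2 (not_le.1 hgt)
      omega

/-- The tag of the elements with colour rule `c` that separate the values at `n` of the partial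
functions with codes `p` and `q`. -/
def mkTag (p q : Code) (c n : ℕ) : ℕ :=
  Nat.pair (Nat.pair (Nat.pair (Encodable.encode p) (Encodable.encode q)) c) n

/-- If no element with this tag lies between `a` and `b` yet, a stage with the same tag and a large
step bound inserts one. -/
theorem exists_between {p q : Code} {c n a b : ℕ} (ha : a ∈ p.eval n) (hb : b ∈ q.eval n)
    (hab : Before w a b)
    (hj : ∀ j ≤ Nat.pair (Nat.pair (Encodable.encode p) (Encodable.encode q)) c +
      {i | i < n ∧ ¬ (w.eval i).Dom}.ncard, Before w j a) :
    ∃ x, x.unpair.1 = mkTag p q c n ∧ Before w a x ∧ Before w x b := by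
  obtain ⟨u₁, hu₁⟩ := Code.evaln_complete.1 ha
  obtain ⟨u₂, hu₂⟩ := Code.evaln_complete.1 hb
  have hu₃ : ∃ u₃, ∀ i < n, (w.eval i).Dom → w.evaln u₃ i ≠ none := by
    have : ∀ i, ∃ v, (w.eval i).Dom → w.evaln v i ≠ none := by
      intro i
      by_cases hi : (w.eval i).Dom
      · obtain ⟨y, hy⟩ := Part.dom_iff_mem.1 hi
        obtain ⟨v, hv⟩ := Code.evaln_complete.1 hy
        exact ⟨v, fun _ => by rw [Option.mem_def.1 hv]; simp⟩
      · exact ⟨0, fun h => absurd h hi⟩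
    choose v hv using this
    refine ⟨(Finset.range n).sup v, fun i hi hd => ?_⟩
    obtain ⟨y, hy⟩ := Option.ne_none_iff_exists'.1 (hv i hd)
    have := Code.evaln_mono (Finset.le_sup (f := v) (Finset.mem_range.2 hi)) hy
    rw [Option.mem_def.1 this]
    simp
  obtain ⟨u₃, hu₃⟩ := hu₃
  -- Enough steps for both values and for all acceptances below n, and large enough that `a` and `b`
  -- are already present at stage s ≥ u.
  set u := u₁ + u₂ + u₃ + a + b + 1 with hu
  set s := Nat.pair (mkTag p q c n) u with hs
  have hus : u ≤ s := Nat.right_le_pair _ _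
  by_contra hno
  have hsep : Separates w s a b := by
    refine ⟨?_, ?_, by omega, by omega, ?_, hab, fun x _ hx => hno ⟨x, by simpa [hs] using hx⟩⟩
    · simpa [hs, mkTag, lowerCode] using Code.evaln_mono (by omega) hu₁
    · simpa [hs, mkTag, upperCode] using Code.evaln_mono (by omega) hu₂
    · intro j hjle _
      refine hj j (hjle.trans ?_)
      simp only [hs, mkTag, Nat.unpair_pair]
      refine Nat.add_le_add_left ?_ _
      rw [survivors, ← List.toFinset_card_of_nodup (List.nodup_range.filter _),
        ← Set.ncard_coe_finset]
      refine Set.ncard_le_ncard (fun i hi => ?_)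
        ((Set.finite_Iio n).subset fun i hi => hi.1)
      simp only [Finset.mem_coe, List.mem_toFinset, List.mem_filter, List.mem_range,
        decide_eq_true_eq] at hi
      refine ⟨hi.1, fun hd => ?_⟩
      obtain ⟨y, hy⟩ := Option.ne_none_iff_exists'.1 (hu₃ i hi.1 hd)
      have := Code.evaln_mono (show u₃ ≤ u by omega) hy
      rw [Option.mem_def.1 this] at hi
      exact absurd hi.2 (by simp)
  exact hno ⟨s, by simp [hs], hsep.before_self, hsep.self_before⟩

end Order

/-! ### Functions computable almost everywhere on a cohesive set -/

open Filter

/-- The filter of the sets that contain almost all elements of `C`. -/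
def almostAll (C : Set ℕ) : Filter ℕ := cofinite ⊓ 𝓟 C

theorem almostSubset_iff {C X : Set ℕ} : AlmostSubset C X ↔ ∀ᶠ n in almostAll C, n ∈ X := by
  rw [almostAll, eventually_inf_principal, eventually_cofinite, AlmostSubset]
  refine Iff.of_eq (congrArg _ (Set.ext fun n => ?_))
  simp

theorem eventually_almostAll_iff {C : Set ℕ} {p : ℕ → Prop} :
    (∀ᶠ n in almostAll C, p n) ↔ ∃ N, ∀ n ∈ C, N ≤ n → p n := by
  rw [almostAll, eventually_inf_principal, Nat.cofinite_eq_atTop, eventually_atTop]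
  exact exists_congr fun N => ⟨fun h n hC hn => h n hn hC, fun h n hn hC => h n hC hn⟩

theorem almostAll_neBot {C : Set ℕ} (hC : C.Infinite) : (almostAll C).NeBot := by
  refine ⟨fun h => hC ?_⟩
  have : ∀ᶠ n in almostAll C, n ∈ (∅ : Set ℕ) := by rw [h]; trivial
  simpa [AlmostSubset] using almostSubset_iff.2 this

/-- `f` agrees on almost all elements of `C` with a partial computable function. -/
def AlmostComputable (C : Set ℕ) (f : ℕ → ℕ) : Prop :=
  ∃ g : ℕ →. ℕ, Partrec g ∧ ∀ᶠ n in almostAll C, f n ∈ g n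

/-- Computability of a relation that is used for unbounded search. -/
def ComputableRel (R : ℕ → ℕ → ℕ → ℕ → Prop) : Prop :=
  ComputablePred fun p : (ℕ × ℕ × ℕ) × ℕ => R p.1.1 p.1.2.1 p.1.2.2 p.2

theorem partrec_search {R : ℕ → ℕ → ℕ → ℕ → Prop} (hR : ComputableRel R) :
    ∃ s : ℕ × ℕ × ℕ →. ℕ, Partrec s ∧ (∀ p, ∀ x ∈ s p, R p.1 p.2.1 p.2.2 x) ∧
      ∀ p, (s p).Dom ↔ ∃ x, R p.1 p.2.1 p.2.2 x := by
  classical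
  refine ⟨fun p => Nat.rfind fun x => Part.some (decide (R p.1 p.2.1 p.2.2 x)),
    Partrec.rfind (ComputablePred.decide hR).partrec, fun p x hx => ?_, fun p => ?_⟩
  · simpa using Nat.rfind_spec hx
  · exact Nat.rfind_dom.trans (by simp)

namespace AlmostComputable

variable {C : Set ℕ} {f g : ℕ → ℕ}

theorem of_computable (hf : Computable f) : AlmostComputable C f :=
  ⟨fun n => Part.some (f n), hf.partrec, Eventually.of_forall fun _ => Part.mem_some _⟩

theorem comp {h : ℕ → ℕ} (hh : Computable h) (hf : AlmostComputable C f) :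
    AlmostComputable C fun n => h (f n) := by
  obtain ⟨φ, hφ, hfφ⟩ := hf
  exact ⟨fun n => (φ n).map h, hφ.map (hh.comp Computable.snd).to₂, by
    filter_upwards [hfφ] with n hn using Part.mem_map h hn⟩

theorem exists_code (hf : AlmostComputable C f) :
    ∃ c : Code, ∀ᶠ n in almostAll C, f n ∈ c.eval n := by
  obtain ⟨φ, hφ, hfφ⟩ := hf
  obtain ⟨c, rfl⟩ := Code.exists_code.1 (Partrec.nat_iff.1 hφ)
  exact ⟨c, hfφ⟩

/-- Unbounded search along two almost computable functions. -/
theorem exists_partrec_search (hf : AlmostComputable C f) (hg : AlmostComputable C g)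
    {R : ℕ → ℕ → ℕ → ℕ → Prop} (hR : ComputableRel R) :
    ∃ s : ℕ →. ℕ, Partrec s ∧ ∀ᶠ n in almostAll C, (∀ x ∈ s n, R n (f n) (g n) x) ∧
      ((s n).Dom ↔ ∃ x, R n (f n) (g n) x) := by
  obtain ⟨φ, hφ, hfφ⟩ := hf
  obtain ⟨ψ, hψ, hgψ⟩ := hg
  obtain ⟨s, hs, hsR, hsdom⟩ := partrec_search hR
  refine ⟨fun n => (φ n).bind fun a => (ψ n).bind fun b => s (n, a, b), ?_, ?_⟩
  · have hargs : Computable fun p : (ℕ × ℕ) × ℕ => (p.1.1, p.1.2, p.2) :=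
      (Computable.fst.comp Computable.fst).pair
        ((Computable.snd.comp Computable.fst).pair Computable.snd)
    have hin : Partrec fun p : ℕ × ℕ => (ψ p.1).bind fun b => s (p.1, p.2, b) :=
      (hψ.comp Computable.fst).bind (hs.comp hargs).to₂
    exact hφ.bind hin.to₂
  · filter_upwards [hfφ, hgψ] with n h₁ h₂
    rw [Part.eq_some_iff.2 h₁, Part.eq_some_iff.2 h₂, Part.bind_some, Part.bind_some]
    exact ⟨hsR _, hsdom _⟩

theorem search (hf : AlmostComputable C f) (hg : AlmostComputable C g)
    {R : ℕ → ℕ → ℕ → ℕ → Prop} (hR : ComputableRel R)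
    (h : ∀ᶠ n in almostAll C, ∃ x, R n (f n) (g n) x) :
    ∃ θ, AlmostComputable C θ ∧ ∀ᶠ n in almostAll C, R n (f n) (g n) (θ n) := by
  classical
  obtain ⟨s, hs, hsR⟩ := exists_partrec_search hf hg hR
  have hdom : ∀ᶠ n in almostAll C, ∃ x, x ∈ s n := by
    filter_upwards [hsR, h] with n h₁ h₂ using Part.dom_iff_mem.1 (h₁.2.2 h₂)
  have hθ : ∀ᶠ n in almostAll C, (if h : (s n).Dom then (s n).get h else 0) ∈ s n := by
    filter_upwards [hdom] with n hn
    rw [dif_pos (Part.dom_iff_mem.2 hn)]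
    exact Part.get_mem _
  refine ⟨_, ⟨s, hs, hθ⟩, ?_⟩
  filter_upwards [hθ, hsR] with n h₁ h₂ using h₂.1 _ h₁

/-- Cohesiveness decides the `Σ₁` properties of almost computable functions. -/
theorem dichotomy (hC : IsCohesive C) (hf : AlmostComputable C f) (hg : AlmostComputable C g)
    {R : ℕ → ℕ → ℕ → ℕ → Prop} (hR : ComputableRel R) :
    (∀ᶠ n in almostAll C, ∃ x, R n (f n) (g n) x) ∨
      ∀ᶠ n in almostAll C, ¬ ∃ x, R n (f n) (g n) x := by
  obtain ⟨s, hs, hsR⟩ := exists_partrec_search hf hg hR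
  refine (hC.2 {n | (s n).Dom} hs.dom_re).imp (fun h => ?_) fun h => ?_
  · filter_upwards [hsR, almostSubset_iff.1 h] with n h₁ h₂ using h₁.2.1 h₂
  · filter_upwards [hsR, almostSubset_iff.1 h] with n h₁ h₂ h₃ using h₂ (h₁.2.2 h₃)

theorem dichotomy_rel (hC : IsCohesive C) (hf : AlmostComputable C f) (hg : AlmostComputable C g)
    {r : ℕ → ℕ → Prop} (hr : ComputablePred fun p : ℕ × ℕ => r p.1 p.2) :
    (∀ᶠ n in almostAll C, r (f n) (g n)) ∨ ∀ᶠ n in almostAll C, ¬ r (f n) (g n) := by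
  have hR : ComputableRel fun _ a b _ => r a b := by
    obtain ⟨_, h⟩ := hr
    exact ⟨fun _ => inferInstance, h.comp (Computable.snd.comp Computable.fst)⟩
  simpa using dichotomy hC hf hg hR

end AlmostComputable

/-! ### Growth along a co-c.e. cohesive set -/

section Growth

variable {C : Set ℕ} {w : Code}

/-- With a = f(n), the existence of such a stage x says that f(n) exceeds f(m) for all m < n in `C`
from `M` on. Elements outside `C` are dismissed by enumeration, which makes this a Σ₁ property. -/
theorem computableRel_record (w c : Code) (M : ℕ) : ComputableRel fun n a _ x =>
    ∀ m < n, m < M ∨ w.evaln x m ≠ none ∨ c.evaln x m ≠ none ∧ (c.evaln x m).getD 0 < a := by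
  refine PrimrecPred.computablePred (primrecPred_forall_lt ?_ (Primrec.fst.comp Primrec.fst))
  let α := ℕ × ((ℕ × ℕ × ℕ) × ℕ)
  have hx : Primrec fun y : α => y.2.2 := Primrec.snd.comp Primrec.snd
  have ha : Primrec fun y : α => y.2.1.2.1 :=
    Primrec.fst.comp (Primrec.snd.comp (Primrec.fst.comp Primrec.snd))
  have he : ∀ d : Code, Primrec fun y : α => d.evaln y.2.2 y.1 := fun d =>
    primrec_evaln_comp hx (Primrec.const d) Primrec.fst
  have hne : ∀ d : Code, PrimrecPred fun y : α => d.evaln y.2.2 y.1 ≠ none := fun d =>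
    (Primrec.eq.comp (he d) (Primrec.const none)).not
  exact PrimrecPred.or (Primrec.nat_lt.comp Primrec.fst (Primrec.const M)) (PrimrecPred.or (hne w)
    (PrimrecPred.and (hne c)
      (Primrec.nat_lt.comp (Primrec.option_getD.comp (he c) (Primrec.const 0)) ha)))

/-- An almost computable function that tends to infinity on a co-c.e. cohesive set is eventually
strictly increasing on that set. -/
theorem eventually_strictMonoOn (hC : IsCohesive C) (hw : ∀ n, (w.eval n).Dom ↔ n ∉ C) {f : ℕ → ℕ}
    (hf : AlmostComputable C f) (hlim : ∀ k, ∀ᶠ n in almostAll C, k < f n) :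
    ∃ N, ∀ m ∈ C, ∀ n ∈ C, N ≤ m → m < n → f m < f n := by
  obtain ⟨c, hc⟩ := hf.exists_code
  obtain ⟨M, hM⟩ := eventually_almostAll_iff.1 hc
  have hval : ∀ m ∈ C, M ≤ m → ∀ x, c.evaln x m ≠ none → (c.evaln x m).getD 0 = f m := by
    intro m hmC hm x hx
    obtain ⟨y, hy⟩ := Option.ne_none_iff_exists'.1 hx
    rw [hy]
    exact Part.mem_unique (Code.evaln_sound hy) (hM m hmC hm)
  rcases AlmostComputable.dichotomy hC hf hf (computableRel_record w c M) with h | h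
  · obtain ⟨N, hN⟩ := eventually_almostAll_iff.1 h
    refine ⟨max M N, fun m hm n hn hle hlt => ?_⟩
    obtain ⟨x, hx⟩ := hN n hn ((le_max_right M N).trans (hle.trans hlt.le))
    rcases hx m hlt with h | h | ⟨h, h'⟩
    · have := le_max_left M N; omega
    · obtain ⟨y, hy⟩ := Option.ne_none_iff_exists'.1 h
      exact absurd hm ((hw m).1 (Part.dom_iff_mem.2 ⟨y, Code.evaln_sound hy⟩))
    · rwa [hval m hm ((le_max_left M N).trans hle) x h] at h'
  · exfalso
    obtain ⟨N, hN⟩ := eventually_almostAll_iff.1 h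
    -- `K` bounds f below both `M` and `N`. So the least n ≥ M in `C` with K < f(n) lies beyond `N`,
    -- and the earlier values on `C` from `M` on are at most `K`: f has a record at n after all.
    set K := (Finset.range (max M N)).sup f with hK
    have hex : ∃ n, n ∈ C ∧ K < f n ∧ M ≤ n := by
      have := almostAll_neBot hC.1
      have hMC : ∀ᶠ n in almostAll C, n ∈ C ∧ M ≤ n :=
        eventually_almostAll_iff.2 ⟨M, fun n h₁ h₂ => ⟨h₁, h₂⟩⟩
      obtain ⟨n, h₁, h₂⟩ := ((hlim K).and hMC).exists
      exact ⟨n, h₂.1, h₁, h₂.2⟩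
    classical
    obtain ⟨hnC, hnK, hnM⟩ := Nat.find_spec hex
    set n := Nat.find hex with hn
    have hnN : N ≤ n := by
      by_contra hlt
      have hlt' : n < max M N := lt_max_of_lt_right (not_le.1 hlt)
      have := Finset.le_sup (f := f) (Finset.mem_range.2 hlt')
      omega
    refine hN n hnC hnN ?_
    have hm : ∀ m, ∃ v, ∀ x, v ≤ x → m < n →
        m < M ∨ w.evaln x m ≠ none ∨ c.evaln x m ≠ none ∧ (c.evaln x m).getD 0 < f n := by
      intro m
      by_cases hmM : m < M
      · exact ⟨0, fun _ _ _ => Or.inl hmM⟩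
      by_cases hmC : m ∈ C
      · obtain ⟨v, hv⟩ := Code.evaln_complete.1 (hM m hmC (not_lt.1 hmM))
        refine ⟨v, fun x hx hmn => Or.inr (Or.inr ?_)⟩
        have hx' := Option.mem_def.1 (Code.evaln_mono hx hv)
        have hmK : ¬ K < f m := fun h => Nat.find_min hex hmn ⟨hmC, h, not_lt.1 hmM⟩
        rw [hx']
        exact ⟨by simp, (not_lt.1 hmK).trans_lt hnK⟩
      · obtain ⟨y, hy⟩ := Part.dom_iff_mem.1 ((hw m).2 hmC)
        obtain ⟨v, hv⟩ := Code.evaln_complete.1 hy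
        refine ⟨v, fun x hx _ => Or.inr (Or.inl ?_)⟩
        rw [Option.mem_def.1 (Code.evaln_mono hx hv)]
        simp
    choose v hv using hm
    exact ⟨(Finset.range n).sup v, fun m hmn =>
      hv m _ (Finset.le_sup (f := v) (Finset.mem_range.2 hmn)) hmn⟩

/-- From some `N` on, f maps the elements of `C` below n injectively into the numbers below f(n);
the elements below `N` cost only a constant. -/
theorem exists_ncard_le_add (hC : IsCohesive C) (hw : ∀ n, (w.eval n).Dom ↔ n ∉ C) {f : ℕ → ℕ}
    (hf : AlmostComputable C f) (hlim : ∀ k, ∀ᶠ n in almostAll C, k < f n) :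
    ∃ K, ∀ᶠ n in almostAll C, {i | i < n ∧ i ∈ C}.ncard ≤ f n + K := by
  obtain ⟨N, hN⟩ := eventually_strictMonoOn hC hw hf hlim
  refine ⟨N, eventually_almostAll_iff.2 ⟨0, fun n hn _ => ?_⟩⟩
  have hsub : {i | i < n ∧ i ∈ C} ⊆ {i | (i < n ∧ i ∈ C) ∧ N ≤ i} ∪ Set.Iio N := by
    intro i hi
    rcases lt_or_ge i N with h | h
    · exact Or.inr h
    · exact Or.inl ⟨hi, h⟩
  have hfin : {i | (i < n ∧ i ∈ C) ∧ N ≤ i}.Finite :=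
    (Set.finite_Iio n).subset fun i hi => hi.1.1
  have hcard : {i | (i < n ∧ i ∈ C) ∧ N ≤ i}.ncard ≤ (Set.Iio (f n)).ncard := by
    refine Set.ncard_le_ncard_of_injOn f (fun i hi => hN i hi.1.2 n hn hi.2 hi.1.1) ?_
      (Set.finite_Iio _)
    intro i hi j hj hij
    rcases lt_trichotomy i j with h | h | h
    · exact absurd hij (hN i hi.1.2 j hj.1.2 hi.2 h).ne
    · exact h
    · exact absurd hij (hN j hj.1.2 i hi.1.2 hj.2 h).ne'
  have hIio : ∀ k : ℕ, (Set.Iio k).ncard = k := fun k => by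
    rw [← Finset.coe_Iio, Set.ncard_coe_finset, Nat.card_Iio]
  calc _ ≤ _ := Set.ncard_le_ncard hsub (hfin.union (Set.finite_Iio N))
    _ ≤ _ := Set.ncard_union_le _ _
    _ ≤ _ := by rw [hIio] at hcard ⊢; omega

/-- An almost computable function that tends to infinity on a co-c.e. cohesive set dominates the
counting function of that set. -/
theorem eventually_add_ncard_lt (hC : IsCohesive C) (hw : ∀ n, (w.eval n).Dom ↔ n ∉ C) {f : ℕ → ℕ}
    (hf : AlmostComputable C f) (hlim : ∀ k, ∀ᶠ n in almostAll C, k < f n) (e : ℕ) :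
    ∀ᶠ n in almostAll C, e + {i | i < n ∧ i ∈ C}.ncard < f n := by
  -- Bounding the count by f/2 + K leaves the other half of f to absorb the constants e and `K`.
  have hhalf : Computable fun m : ℕ => m / 2 :=
    (Primrec.nat_div.comp Primrec.id (Primrec.const 2)).to_comp
  obtain ⟨K, hK⟩ := exists_ncard_le_add hC hw (hf.comp hhalf) fun k => by
    filter_upwards [hlim (2 * k + 1)] with n hn
    omega
  filter_upwards [hK, hlim (2 * (e + K) + 2)] with n h₁ h₂
  omega

end Growth

/-! ### Elements of the power through total representing functions -/

section Represents

variable {C : Set ℕ}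

/-- `x` is the class of a partial function that agrees with `f` on almost all of `C`. -/
def Represents (x : Power Set.univ C) (f : ℕ → ℕ) : Prop :=
  ∃ φ : Rep Set.univ C, Power.mk φ = x ∧ ∀ᶠ n in almostAll C, f n ∈ φ.1 n

theorem exists_represents (x : Power Set.univ C) : ∃ f, Represents x f := by
  classical
  induction x using Quotient.inductionOn with
  | h φ =>
    refine ⟨fun n => if h : (φ.1 n).Dom then (φ.1 n).get h else 0, φ, rfl, ?_⟩
    filter_upwards [almostSubset_iff.1 φ.2.2.2] with n hn
    have hn' : (φ.1 n).Dom := hn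
    rw [dif_pos hn']
    exact Part.get_mem _

theorem AlmostComputable.exists_power {f : ℕ → ℕ} (hf : AlmostComputable C f) :
    ∃ x : Power Set.univ C, Represents x f := by
  obtain ⟨φ, hφ, h⟩ := hf
  refine ⟨_, ⟨φ, hφ, fun _ _ _ => trivial, almostSubset_iff.2 ?_⟩, rfl, h⟩
  filter_upwards [h] with n hn using Part.dom_iff_mem.2 ⟨_, hn⟩

theorem represents_canonicalEmbedding (a : (Set.univ : Set ℕ)) :
    Represents (canonicalEmbedding C a) fun _ => a :=
  ⟨_, rfl, Eventually.of_forall fun _ => Part.mem_some _⟩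

namespace Represents

variable {x y : Power Set.univ C} {f g : ℕ → ℕ}

theorem almostComputable (h : Represents x f) : AlmostComputable C f := by
  obtain ⟨φ, -, h⟩ := h
  exact ⟨φ.1, φ.2.1, h⟩

theorem eq_iff (hx : Represents x f) (hy : Represents y g) :
    x = y ↔ ∀ᶠ n in almostAll C, f n = g n := by
  obtain ⟨φ, rfl, hφ⟩ := hx
  obtain ⟨ψ, rfl, hψ⟩ := hy
  have h : Power.mk φ = Power.mk ψ ↔ EqC φ ψ := Quotient.eq (r := repSetoid Set.univ C)
  rw [h, EqC, almostSubset_iff]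
  constructor
  · intro h
    filter_upwards [hφ, hψ, h] with n h₁ h₂ ⟨a, h₃, h₄⟩
    rw [Part.mem_unique h₁ h₃, Part.mem_unique h₂ h₄]
  · intro h
    filter_upwards [hφ, hψ, h] with n h₁ h₂ h₃
    exact ⟨f n, h₁, h₃ ▸ h₂⟩

theorem powerRel_iff (hx : Represents x f) (hy : Represents y g) {r : ℕ → ℕ → Prop} :
    powerRel r x y ↔ ∀ᶠ n in almostAll C, r (f n) (g n) := by
  obtain ⟨φ, rfl, hφ⟩ := hx
  obtain ⟨ψ, rfl, hψ⟩ := hy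
  have h : powerRel r (Power.mk φ) (Power.mk ψ) ↔
      AlmostSubset C {n | ∃ a ∈ φ.1 n, ∃ b ∈ ψ.1 n, r a b} := Iff.rfl
  rw [h, almostSubset_iff]
  constructor
  · intro h
    filter_upwards [hφ, hψ, h] with n h₁ h₂ ⟨a, h₃, b, h₄, h₅⟩
    rwa [Part.mem_unique h₁ h₃, Part.mem_unique h₂ h₄]
  · intro h
    filter_upwards [hφ, hψ, h] with n h₁ h₂ h₃
    exact ⟨f n, h₁, g n, h₂, h₃⟩

theorem isStandard_iff (hx : Represents x f) :
    IsStandard x ↔ ∃ a, ∀ᶠ n in almostAll C, f n = a := by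
  constructor
  · rintro ⟨a, rfl⟩
    exact ⟨a, (hx.eq_iff (represents_canonicalEmbedding a)).1 rfl⟩
  · rintro ⟨a, ha⟩
    exact ⟨⟨a, trivial⟩, ((hx.eq_iff (represents_canonicalEmbedding ⟨a, trivial⟩)).2 ha).symm⟩

theorem isSolid_iff {c : Color C} (hc : Represents c f) :
    IsSolid c ↔ ∃ a, ∀ᶠ n in almostAll C, f n = a := by
  obtain ⟨δ, rfl, hδ⟩ := hc
  have h : IsSolid (Power.mk δ) ↔ ∃ a : ℕ, AlmostSubset C {n | a ∈ δ.1 n} := Iff.rfl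
  rw [h]
  refine exists_congr fun a => almostSubset_iff.trans ⟨fun h => ?_, fun h => ?_⟩
  · filter_upwards [hδ, h] with n h₁ h₂ using Part.mem_unique h₁ h₂
  · filter_upwards [hδ, h] with n h₁ h₂
    exact h₂ ▸ h₁

theorem inducedColoring (hx : Represents x f) {F : ℕ → ℕ} (hF : Computable F) :
    Represents (inducedColoring F hF x) fun n => F (f n) := by
  obtain ⟨φ, rfl, hφ⟩ := hx
  refine ⟨compRep F hF φ, rfl, ?_⟩
  filter_upwards [hφ] with n hn using Part.mem_map F hn

end Represents

instance : Countable (Power Set.univ C) := by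
  have h : ∀ x : Power Set.univ C, ∃ c : Code, ∃ f, Represents x f ∧
      ∀ᶠ n in almostAll C, f n ∈ c.eval n := by
    intro x
    obtain ⟨f, hf⟩ := exists_represents x
    obtain ⟨c, hc⟩ := hf.almostComputable.exists_code
    exact ⟨c, f, hf, hc⟩
  choose c f hf hc using h
  refine Function.Injective.countable (f := c) fun x y hxy => ?_
  refine ((hf x).eq_iff (hf y)).2 ?_
  filter_upwards [hc x, hc y] with n h₁ h₂
  exact Part.mem_unique h₁ (hxy ▸ h₂)

end Represents

/-! ### Recognising ω and ω + η -/

section OrderTypes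

/-- A strict total order on `ℕ` in which every element has finitely many predecessors has
order-type `ω`. -/
theorem nonempty_relIso_nat {r : ℕ → ℕ → Prop} [IsStrictTotalOrder ℕ r]
    (hfin : ∀ x, {y | r y x}.Finite) : Nonempty (r ≃r ((· < ·) : ℕ → ℕ → Prop)) := by
  classical
  let f : ℕ → ℕ := fun x => {y | r y x}.ncard
  have hlt : ∀ x y, r x y → f x < f y := fun x y h =>
    Set.ncard_lt_ncard ⟨fun z hz => trans_of r hz h, fun hsub => irrefl_of r x (hsub h)⟩ (hfin y)
  have hinj : Function.Injective f := by
    intro x y hxy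
    rcases trichotomous_of r x y with h | h | h
    · exact absurd hxy (hlt x y h).ne
    · exact h
    · exact absurd hxy (hlt y x h).ne'
  have : Infinite (Set.range f) := Set.infinite_coe_iff.2 (Set.infinite_range_of_injective hinj)
  have hmap : ∀ x y, f x < f y ↔ r x y := by
    refine fun x y => ⟨fun h => ?_, hlt x y⟩
    rcases trichotomous_of r x y with h' | rfl | h'
    · exact h'
    · exact absurd h (lt_irrefl _)
    · exact absurd h (hlt y x h').asymm
  let e : r ≃r ((· < ·) : Set.range f → Set.range f → Prop) :=
    ⟨Equiv.ofInjective f hinj, fun {x y} => hmap x y⟩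
  exact ⟨e.trans (Nat.Subtype.orderIsoOfNat (Set.range f)).symm.toRelIsoLT⟩

/-- A countable strict total order with an initial segment of order-type `ω` such that the rest is
a non-empty dense order without endpoints has order-type `ω + η`. -/
theorem nonempty_relIso_sumLex {P : Type*} [Countable P] {r : P → P → Prop}
    [IsStrictTotalOrder P r] {e : ℕ → P} (he : ∀ a b, a < b → r (e a) (e b))
    (hinit : ∀ a, ∀ y ∉ Set.range e, r (e a) y)
    (hdense : ∀ x ∉ Set.range e, ∀ y ∉ Set.range e, r x y → ∃ z ∉ Set.range e, r x z ∧ r z y)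
    (hmin : ∀ x ∉ Set.range e, ∃ z ∉ Set.range e, r z x)
    (hmax : ∀ x ∉ Set.range e, ∃ z ∉ Set.range e, r x z) (hne : ∃ x, x ∉ Set.range e) :
    Nonempty (r ≃r ((· < ·) : ℕ ⊕ₗ ℚ → ℕ ⊕ₗ ℚ → Prop)) := by
  classical
  let : LinearOrder P := linearOrderOfSTO r
  let S := {x : P // x ∉ Set.range e}
  have : Nonempty S := ⟨⟨hne.choose, hne.choose_spec⟩⟩
  have : DenselyOrdered S := ⟨fun x y h => by
    obtain ⟨z, hz, h₁, h₂⟩ := hdense x x.2 y y.2 h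
    exact ⟨⟨z, hz⟩, h₁, h₂⟩⟩
  have : NoMinOrder S := ⟨fun x => by
    obtain ⟨z, hz, h⟩ := hmin x x.2
    exact ⟨⟨z, hz⟩, h⟩⟩
  have : NoMaxOrder S := ⟨fun x => by
    obtain ⟨z, hz, h⟩ := hmax x x.2
    exact ⟨⟨z, hz⟩, h⟩⟩
  obtain ⟨i⟩ := Order.iso_of_countable_dense S ℚ
  let g : ℕ ⊕ₗ ℚ → P := fun z => Sum.elim e (fun q => (i.symm q).1) (ofLex z)
  have hg : StrictMono g := by
    intro x y hxy
    rcases Sum.Lex.lt_def.1 hxy with h | h | h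
    · exact he _ _ h
    · exact i.symm.strictMono h
    · exact hinit _ _ (i.symm _).2
  have hsurj : Function.Surjective g := by
    intro x
    by_cases hx : x ∈ Set.range e
    · obtain ⟨a, rfl⟩ := hx
      exact ⟨toLex (Sum.inl a), rfl⟩
    · exact ⟨toLex (Sum.inr (i ⟨x, hx⟩)), by simp [g]⟩
  exact ⟨(hg.orderIsoOfSurjective g hsurj).symm.toRelIsoLT⟩

end OrderTypes

/-- The computable linear order on `ℕ` given by `Before w`. -/
@[reducible]
def orderOfCode (w : Code) : ComputableLinearOrder where
  dom := Set.univ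
  lt := Before w
  dom_nonempty := Set.univ_nonempty
  dom_computable := (Primrec.eq.comp (Primrec.const 0) (Primrec.const 0) :
    PrimrecPred fun _ : ℕ => 0 = 0).computablePred.of_eq fun _ => by simp
  lt_computable := (primrecRel_before w).computablePred
  lt_dom _ _ _ := ⟨trivial, trivial⟩
  irrefl a _ := before_irrefl w a
  asymm _ _ _ _ h h' := before_irrefl w _ (before_trans w h h')
  trans _ _ _ _ _ _ h h' := before_trans w h h'
  total a _ b _ := before_total w a b

instance (w : Code) : IsStrictTotalOrder ℕ (Before w) where
  trichotomous a b h h' := ((before_total w a b).resolve_left h).resolve_right h'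
  irrefl := before_irrefl w
  trans _ _ _ := before_trans w

/-! ### Heights and colours of elements -/

section Height

variable (w : Code)

theorem exists_not_before (a : ℕ) : ∃ j, ¬ Before w j a := ⟨a, before_irrefl w a⟩

open scoped Classical in
/-- The least number that is not below `a`. -/
noncomputable def height (a : ℕ) : ℕ := Nat.find (exists_not_before w a)

theorem computable_height : Computable (height w) := by
  classical
  exact Computable.find ((primrecRel_before w).comp Primrec.snd Primrec.fst).not.computablePred _

theorem before_of_lt_height {j a : ℕ} (h : j < height w a) : Before w j a := by
  classical
  exact not_not.1 (Nat.find_min (exists_not_before w a) h)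

theorem lt_height {k a : ℕ} (h : ∀ j ≤ k, Before w j a) : k < height w a := by
  classical
  exact (Nat.lt_find_iff _ _).2 fun j hj => not_not.2 (h j hj)

end Height

/-- The colouring of the order: elements are coloured by the colour rule in their tags. -/
def tagColor (x : ℕ) : ℕ :=
  Nat.casesOn x.unpair.1.unpair.1.unpair.2 x.unpair.1.unpair.2 fun c => c

theorem computable_tagColor : Computable tagColor :=
  (Primrec.nat_casesOn
    (primrec_snd_unpair.comp (primrec_fst_unpair.comp primrec_fst_unpair))
    (primrec_snd_unpair.comp primrec_fst_unpair) Primrec.snd.to₂).to_comp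

theorem tagColor_of_tag_zero {x n : ℕ} {p q : Code} (h : x.unpair.1 = mkTag p q 0 n) :
    tagColor x = n := by
  simp [tagColor, h, mkTag]

theorem tagColor_of_tag_succ {x n c : ℕ} {p q : Code} (h : x.unpair.1 = mkTag p q (c + 1) n) :
    tagColor x = c := by
  simp [tagColor, h, mkTag]

/-! ### The structure of the cohesive power -/

section CohesivePower

variable {C : Set ℕ} {w : Code}

theorem infinite_not_dom (hC : IsCohesive C) (hw : ∀ n, (w.eval n).Dom ↔ n ∉ C) :
    {n | ¬ (w.eval n).Dom}.Infinite := by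
  simpa [hw] using hC.1

theorem isCopyOfOmega_orderOfCode (hw : {n | ¬ (w.eval n).Dom}.Infinite) :
    (orderOfCode w).IsCopyOfOmega := by
  obtain ⟨e⟩ := nonempty_relIso_nat (r := Before w) fun x =>
    (finite_not_before w hw x).subset fun y hy hxy =>
      before_irrefl w x (before_trans w hxy hy)
  have e' : (fun a b : (orderOfCode w).dom => (orderOfCode w).lt a b) ≃r Before w :=
    ⟨Equiv.Set.univ ℕ, Iff.rfl⟩
  exact ⟨e'.trans e⟩

/-- Only finitely many elements fail to be above k, and by cohesiveness a non-standard element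
avoids each of them almost everywhere. -/
theorem Represents.not_isStandard_iff (hC : IsCohesive C) (hw : ∀ n, (w.eval n).Dom ↔ n ∉ C)
    {x : Power Set.univ C} {f : ℕ → ℕ} (hx : Represents x f) :
    ¬ IsStandard x ↔ ∀ k, ∀ᶠ n in almostAll C, Before w k (f n) := by
  have := almostAll_neBot hC.1
  rw [hx.isStandard_iff]
  constructor
  · intro h k
    have hne : ∀ a, ∀ᶠ n in almostAll C, f n ≠ a := by
      intro a
      refine (AlmostComputable.dichotomy_rel hC hx.almostComputable
        (AlmostComputable.of_computable (Computable.const a)) (r := (· = ·))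
        Primrec.eq.computablePred).resolve_left fun h' => h ⟨a, h'⟩
    have hfin := finite_not_before w (infinite_not_dom hC hw) k
    filter_upwards [(hfin.eventually_all).2 fun a _ => hne a] with n hn
    by_contra hbef
    exact hn (f n) hbef rfl
  · rintro h ⟨a, ha⟩
    obtain ⟨n, h₁, h₂⟩ := ((h a).and ha).exists
    exact before_irrefl w a (h₂ ▸ h₁)

theorem isStrictTotalOrder_powerLt (hC : IsCohesive C) :
    IsStrictTotalOrder (Power Set.univ C) (powerRel (Before w)) where
  trichotomous x y h h' := by
    obtain ⟨f, hf⟩ := exists_represents x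
    obtain ⟨g, hg⟩ := exists_represents y
    rw [hf.powerRel_iff hg] at h
    rw [hg.powerRel_iff hf] at h'
    rw [hf.eq_iff hg]
    have h₁ := (AlmostComputable.dichotomy_rel hC hf.almostComputable hg.almostComputable
      (primrecRel_before w).computablePred).resolve_left h
    have h₂ := (AlmostComputable.dichotomy_rel hC hg.almostComputable hf.almostComputable
      (primrecRel_before w).computablePred).resolve_left h'
    filter_upwards [h₁, h₂] with n h₁ h₂
    exact ((before_total w _ _).resolve_left h₁).resolve_right h₂
  irrefl x h := by
    obtain ⟨f, hf⟩ := exists_represents x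
    have := almostAll_neBot hC.1
    obtain ⟨n, hn⟩ := ((hf.powerRel_iff hf).1 h).exists
    exact before_irrefl w _ hn
  trans x y z h h' := by
    obtain ⟨f, hf⟩ := exists_represents x
    obtain ⟨g, hg⟩ := exists_represents y
    obtain ⟨k, hk⟩ := exists_represents z
    rw [hf.powerRel_iff hg] at h
    rw [hg.powerRel_iff hk] at h'
    rw [hf.powerRel_iff hk]
    filter_upwards [h, h'] with n h₁ h₂ using before_trans w h₁ h₂

theorem eventually_lt_height (hC : IsCohesive C) (hw : ∀ n, (w.eval n).Dom ↔ n ∉ C)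
    {x : Power Set.univ C} {f : ℕ → ℕ} (hx : Represents x f) (hns : ¬ IsStandard x) (k : ℕ) :
    ∀ᶠ n in almostAll C, k < height w (f n) := by
  filter_upwards [((Set.finite_Iic k).eventually_all).2 fun j _ =>
    (hx.not_isStandard_iff hC hw).1 hns j] with n hn
  exact lt_height w hn

/-- Between any two non-standard elements there are elements separating them with any given
colour rule. -/
theorem exists_between_nonstandard (hC : IsCohesive C) (hw : ∀ n, (w.eval n).Dom ↔ n ∉ C)
    {x y : Power Set.univ C} (hy : ¬ IsStandard y) (hyx : powerRel (Before w) y x) (c : ℕ) :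
    ∃ (z : Power Set.univ C) (θ : ℕ → ℕ), Represents z θ ∧ ¬ IsStandard z ∧
      powerRel (Before w) y z ∧ powerRel (Before w) z x ∧
      ∃ p q : Code, ∀ᶠ n in almostAll C, (θ n).unpair.1 = mkTag p q c n := by
  obtain ⟨f, hf⟩ := exists_represents x
  obtain ⟨g, hg⟩ := exists_represents y
  obtain ⟨q, hq⟩ := hf.almostComputable.exists_code
  obtain ⟨p, hp⟩ := hg.almostComputable.exists_code
  -- The height of g(n) exceeds the final restraint of the tag at n.
  have hdom := eventually_add_ncard_lt hC hw (hg.almostComputable.comp (computable_height w))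
    (eventually_lt_height hC hw hg hy)
    (Nat.pair (Nat.pair (Encodable.encode p) (Encodable.encode q)) c)
  have hgf := (hg.powerRel_iff hf).1 hyx
  have hset : ∀ n, {i | i < n ∧ ¬ (w.eval i).Dom} = {i | i < n ∧ i ∈ C} := fun n => by simp [hw]
  have hR : ComputableRel fun n a b z => z.unpair.1 = mkTag p q c n ∧ Before w a z ∧
      Before w z b := by
    refine PrimrecPred.computablePred (PrimrecPred.and ?_ (PrimrecPred.and ?_ ?_))
    · exact Primrec.eq.comp (primrec_fst_unpair.comp Primrec.snd)
        (Primrec₂.natPair.comp (Primrec.const _) (Primrec.fst.comp Primrec.fst))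
    · exact (primrecRel_before w).comp (Primrec.fst.comp (Primrec.snd.comp Primrec.fst)) Primrec.snd
    · exact (primrecRel_before w).comp Primrec.snd (Primrec.snd.comp (Primrec.snd.comp Primrec.fst))
  obtain ⟨θ, hθ, hθR⟩ := AlmostComputable.search hg.almostComputable hf.almostComputable hR (by
    filter_upwards [hp, hq, hgf, hdom] with n h₁ h₂ h₃ h₄
    refine exists_between w h₁ h₂ h₃ fun j hj => before_of_lt_height w (lt_of_le_of_lt hj ?_)
    rwa [hset])
  obtain ⟨z, hz⟩ := hθ.exists_power
  refine ⟨z, θ, hz, ?_, ?_, ?_, p, q, ?_⟩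
  · rw [hz.not_isStandard_iff hC hw]
    intro k
    filter_upwards [(hg.not_isStandard_iff hC hw).1 hy k, hθR] with n h₁ h₂
    exact before_trans w h₁ h₂.2.1
  · rw [hg.powerRel_iff hz]
    filter_upwards [hθR] with n h using h.2.1
  · rw [hz.powerRel_iff hf]
    filter_upwards [hθR] with n h using h.2.2
  · filter_upwards [hθR] with n h using h.1

/-- The number just under the height of f(n) is below f(n) in the order, and it tends to infinity,
so it is not almost constant. -/
theorem exists_nonstandard_below (hC : IsCohesive C) (hw : ∀ n, (w.eval n).Dom ↔ n ∉ C)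
    {x : Power Set.univ C} (hx : ¬ IsStandard x) :
    ∃ z : Power Set.univ C, ¬ IsStandard z ∧ powerRel (Before w) z x := by
  have := almostAll_neBot hC.1
  obtain ⟨f, hf⟩ := exists_represents x
  obtain ⟨z, hz⟩ := (hf.almostComputable.comp
    (Computable.pred.comp (computable_height w))).exists_power
  refine ⟨z, ?_, ?_⟩
  · rw [hz.isStandard_iff]
    rintro ⟨a, ha⟩
    obtain ⟨n, h₁, h₂⟩ := (ha.and (eventually_lt_height hC hw hf hx (a + 1))).exists
    simp only [Nat.pred_eq_sub_one] at h₁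
    omega
  · rw [hz.powerRel_iff hf]
    filter_upwards [eventually_lt_height hC hw hf hx 0] with n hn
    exact before_of_lt_height w (Nat.pred_lt hn.ne')

theorem exists_nonstandard_above (hC : IsCohesive C) (hw : ∀ n, (w.eval n).Dom ↔ n ∉ C)
    {x : Power Set.univ C} (hx : ¬ IsStandard x) :
    ∃ z : Power Set.univ C, ¬ IsStandard z ∧ powerRel (Before w) x z := by
  obtain ⟨f, hf⟩ := exists_represents x
  have hR : ComputableRel fun _ a _ z => Before w a z :=
    PrimrecPred.computablePred
      ((primrecRel_before w).comp (Primrec.fst.comp (Primrec.snd.comp Primrec.fst)) Primrec.snd)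
  obtain ⟨θ, hθ, hθR⟩ := AlmostComputable.search hf.almostComputable hf.almostComputable hR
    (Eventually.of_forall fun n => by
      obtain ⟨z, hz⟩ := (finite_not_before w (infinite_not_dom hC hw) (f n)).exists_notMem
      exact ⟨z, not_not.1 hz⟩)
  obtain ⟨z, hz⟩ := hθ.exists_power
  refine ⟨z, ?_, (hf.powerRel_iff hz).2 hθR⟩
  rw [hz.not_isStandard_iff hC hw]
  intro k
  filter_upwards [(hf.not_isStandard_iff hC hw).1 hx k, hθR] with n h₁ h₂
  exact before_trans w h₁ h₂

theorem exists_nonstandard (hC : IsCohesive C) :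
    ∃ x : Power Set.univ C, ¬ IsStandard x := by
  obtain ⟨x, hx⟩ := (AlmostComputable.of_computable (C := C) Computable.id).exists_power
  refine ⟨x, ?_⟩
  rw [hx.isStandard_iff]
  rintro ⟨a, ha⟩
  obtain ⟨N, hN⟩ := eventually_almostAll_iff.1 ha
  obtain ⟨n, hn, hlt⟩ := hC.1.exists_gt (max a N)
  have := hN n hn ((le_max_right a N).trans hlt.le)
  exact absurd this ((le_max_left a N).trans_lt hlt).ne'

theorem nonempty_power_relIso (hC : IsCohesive C) (hw : ∀ n, (w.eval n).Dom ↔ n ∉ C) :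
    Nonempty (powerRel (A := Set.univ) (C := C) (Before w) ≃r
      ((· < ·) : ℕ ⊕ₗ ℚ → ℕ ⊕ₗ ℚ → Prop)) := by
  obtain ⟨i⟩ := isCopyOfOmega_orderOfCode (infinite_not_dom hC hw)
  let e : ℕ → Power Set.univ C := fun a => canonicalEmbedding C (i.symm a)
  have hrange : ∀ x, x ∈ Set.range e ↔ IsStandard x := fun x =>
    Set.ext_iff.1 (i.symm.surjective.range_comp (canonicalEmbedding C)) x
  have := isStrictTotalOrder_powerLt (w := w) hC
  refine nonempty_relIso_sumLex (e := e) ?_ ?_ ?_ ?_ ?_ ?_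
  · intro a b hab
    exact ((represents_canonicalEmbedding _).powerRel_iff (represents_canonicalEmbedding _)).2
      (Eventually.of_forall fun _ => i.symm.map_rel_iff.2 hab)
  · intro a y hy
    rw [hrange] at hy
    obtain ⟨g, hg⟩ := exists_represents y
    exact ((represents_canonicalEmbedding _).powerRel_iff hg).2
      ((hg.not_isStandard_iff hC hw).1 hy _)
  all_goals simp only [hrange]
  · intro x hx y _ hxy
    obtain ⟨z, -, -, hz, h₁, h₂, -⟩ := exists_between_nonstandard hC hw hx hxy 0
    exact ⟨z, hz, h₁, h₂⟩
  · exact fun x hx => exists_nonstandard_below hC hw hx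
  · exact fun x hx => exists_nonstandard_above hC hw hx
  · exact exists_nonstandard hC

end CohesivePower

end CohPow

theorem mainTheorem2 (C : Set ℕ) (hcoce : CohPow.IsCoCE C) (hcoh : CohPow.IsCohesive C) :
    ∃ L : CohPow.ComputableLinearOrder,
      L.dom = Set.univ ∧
      L.IsCopyOfOmega ∧
      Nonempty (L.powerLt C ≃r ((· < ·) : ℕ ⊕ₗ ℚ → ℕ ⊕ₗ ℚ → Prop)) ∧
      ∃ (F : ℕ → ℕ) (hF : Computable F),
        ∀ x y : L.Power C, ¬ CohPow.IsStandard x → ¬ CohPow.IsStandard y → L.powerLt C y x →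
          (∀ c : CohPow.Color C, CohPow.IsSolid c →
            ∃ z : L.Power C, ¬ CohPow.IsStandard z ∧ L.powerLt C y z ∧ L.powerLt C z x ∧
              CohPow.inducedColoring F hF z = c) ∧
          (∃ z : L.Power C, ¬ CohPow.IsStandard z ∧ L.powerLt C y z ∧ L.powerLt C z x ∧
              CohPow.IsStriped (CohPow.inducedColoring F hF z)) := by
  obtain ⟨w, hw⟩ : ∃ w : Nat.Partrec.Code, ∀ n, (w.eval n).Dom ↔ n ∉ C := by
    -- Semi-decidability of the complement becomes a code by returning 0 on acceptance.
    obtain ⟨w, hw⟩ := Nat.Partrec.Code.exists_code.1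
      (Partrec.nat_iff.1 (Partrec.map hcoce (Computable.const 0).to₂))
    exact ⟨w, fun n => by rw [hw]; simp [Part.assert]⟩
  refine ⟨CohPow.orderOfCode w, rfl,
    CohPow.isCopyOfOmega_orderOfCode (CohPow.infinite_not_dom hcoh hw),
    CohPow.nonempty_power_relIso hcoh hw, CohPow.tagColor, CohPow.computable_tagColor,
    fun x y _ hy hyx => ⟨fun c hc => ?_, ?_⟩⟩
  · obtain ⟨δ, hδ⟩ := CohPow.exists_represents c
    obtain ⟨a, ha⟩ := hδ.isSolid_iff.1 hc
    -- The shift by one leaves rule 0 free for the striped colour.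
    obtain ⟨z, θ, hθ, hz, h₁, h₂, p, q, htag⟩ :=
      CohPow.exists_between_nonstandard hcoh hw hy hyx (a + 1)
    refine ⟨z, hz, h₁, h₂, ((hθ.inducedColoring CohPow.computable_tagColor).eq_iff hδ).2 ?_⟩
    filter_upwards [ha, htag] with n h₃ h₄
    rw [h₃, CohPow.tagColor_of_tag_succ h₄]
  -- Under rule 0 the colour at n is n itself, which is not almost constant on an infinite set.
  · obtain ⟨z, θ, hθ, hz, h₁, h₂, p, q, htag⟩ :=
      CohPow.exists_between_nonstandard hcoh hw hy hyx 0
    refine ⟨z, hz, h₁, h₂, fun hs => ?_⟩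
    obtain ⟨a, ha⟩ := (hθ.inducedColoring CohPow.computable_tagColor).isSolid_iff.1 hs
    have := CohPow.almostAll_neBot hcoh.1
    obtain ⟨N, hN⟩ := CohPow.eventually_almostAll_iff.1 (ha.and htag)
    obtain ⟨n, hn, hlt⟩ := hcoh.1.exists_gt (max a N)
    obtain ⟨h₃, h₄⟩ := hN n hn ((le_max_right a N).trans hlt.le)
    rw [CohPow.tagColor_of_tag_zero h₄] at h₃
    exact absurd h₃ ((le_max_left a N).trans_lt hlt).ne'
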